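/- **Setting.** Let $\mathrm{IP}$ be a set of addresses. A network is a finite parallel composition, in the process algebra AWN (Algebra for Wireless Networks), of nodes with pairwise distinct addresses. Each node runs the AODV routing protocol specified below in parallel with a FIFO queue of incoming messages; the links between nodes may go up and down at any time. Initially every node has an empty routing table, no recorded route requests, no queued packets or messages, and its own sequence number $\mathit{sn}$ is $1$; the initial links are arbitrary. The only input from outside is the injection, at a node, of a data packet for some destination. A network state $N$ (the values of all variables and the control points of all nodes) is *reachable* if some sequence of transitions leads to it from an initial state. Assignments, tests and hand-overs from the queue are internal transitions of their own. A transition $N\xrightarrow{R:\mathbf{broadcast}(m)}N'$ is the broadcast of the message $m$ by one of the nodes, $R$ being the set of addresses in its range. A routing table $\mathit{rt}$ has at most one entry $(\mathit{dip},\mathit{dsn},\mathit{flag},\mathit{hops},\mathit{nhip},\mathit{pre})$ for each destination $\mathit{dip}$: a sequence number ($0$ means unknown), a flag (valid or invalid), a hop count, a next hop, and a set of precursors. An update of $\mathit{rt}$ with an entry $r$ inserts $r$ if there is no entry $s$ for its destination. Otherwise $s$ is replaced by $r$ if $\mathit{dsn}(s)<\mathit{dsn}(r)$, or if $\mathit{dsn}(s)=\mathit{dsn}(r)$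 and either $\mathit{hops}(s)>\mathit{hops}(r)$ or $s$ is invalid; failing these, if $\mathit{dsn}(r)=0$, then $s$ is replaced by $r$ with sequence number $\mathit{dsn}(s)$; in all other cases $s$ stays. In each of these cases the new entry has the precursors of both $r$ and $s$. A route request has the form $\mathrm{rreq}(\mathit{hops},\mathit{rreqid},\mathit{dip},\mathit{dsn},\mathit{oip},\mathit{osn},\mathit{sip})$: hop count, request identifier, requested destination, last known sequence number of the destination, originator, sequence number of the originator, and sender. Node $\mathit{ip}$ behaves as follows. * *Any control message (request, reply, error) from $\mathit{sip}$:* first update $\mathit{rt}$ with $(\mathit{sip},0,\text{valid},1,\mathit{sip},\emptyset)$. * *Route request:* ignore it if $(\mathit{oip},\mathit{rreqid})$ is recorded. Otherwise update $\mathit{rt}$ with $(\mathit{oip},\mathit{osn},\text{valid},\mathit{hops}+1,\mathit{sip},\emptyset)$ and record $(\mathit{oip},\mathit{rreqid})$. If $\mathit{dip}=\mathit{ip}$, set $\mathit{sn}:=\max(\mathit{sn},\mathit{dsn})$ and unicast a reply with hop count $0$ and sequence number $\mathit{sn}$ to the next hop towards $\mathit{oip}$. If $\mathit{dip}\ne\mathit{ip}$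 and there is a valid entry for $\mathit{dip}$ with a known sequence number that is at least $\mathit{dsn}$, add the precursor $\mathit{sip}$ to the entry for $\mathit{dip}$ and the next hop towards $\mathit{dip}$ to the precursors for $\mathit{oip}$, and unicast a reply with the hop count and the sequence number of the entry for $\mathit{dip}$ to the next hop towards $\mathit{oip}$. In the remaining case broadcast $\mathrm{rreq}(\mathit{hops}+1,\mathit{rreqid},\mathit{dip},\max(\mathit{sqn},\mathit{dsn}),\mathit{oip},\mathit{osn},\mathit{ip})$, where $\mathit{sqn}$ is the sequence number for $\mathit{dip}$ in $\mathit{rt}$ ($0$ if there is no entry). * *Route reply $\mathrm{rrep}(\mathit{hops},\mathit{dip},\mathit{dsn},\mathit{oip},\mathit{sip})$:* ignore it if an update with $(\mathit{dip},\mathit{dsn},\text{valid},\mathit{hops}+1,\mathit{sip},\emptyset)$ does not change $\mathit{rt}$. Otherwise perform that update and, if $\mathit{oip}\ne\mathit{ip}$ and there is a valid route to $\mathit{oip}$, add the next hop towards $\mathit{oip}$ to the precursors for $\mathit{dip}$ and for the next hop towards $\mathit{dip}$, and unicast $\mathrm{rrep}(\mathit{hops}+1,\mathit{dip},\mathit{dsn},\mathit{oip},\mathit{ip})$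 to the next hop towards $\mathit{oip}$. * *Route error from $\mathit{sip}$, a set of pairs $(\mathit{rip},\mathit{rsn})$:* invalidate exactly those listed destinations $\mathit{rip}$ that have a valid entry with next hop $\mathit{sip}$ and sequence number less than $\mathit{rsn}$, set their sequence numbers to $\mathit{rsn}$, and send an error listing those of them with precursors to all these precursors. * *Data packet:* deliver it if it is for $\mathit{ip}$; otherwise unicast it to the next hop if there is a valid route to its destination $\mathit{dip}$. If there is no valid route and the packet originates at $\mathit{ip}$, queue it, increment $\mathit{sn}$, record a fresh request identifier $\mathit{rreqid}$, and broadcast $\mathrm{rreq}(0,\mathit{rreqid},\mathit{dip},\mathit{sqn},\mathit{ip},\mathit{sn},\mathit{ip})$. If there is no valid route and it originates elsewhere, an error for $\mathit{dip}$ with the stored sequence number is sent to the precursors for $\mathit{dip}$ if the entry for $\mathit{dip}$ is invalid, and nothing happens if there is no entry. A queued packet may be sent whenever a valid route to its destination is known. * *Failed unicast:* every valid entry with the unreachable next hop is invalidated, its sequence number is incremented unless it is $0$, and an error listing those of these destinations with precursors is sent to all these precursors. **Proposition.** Let $N$ be a reachable network state and let $$N\xrightarrow{R:\mathbf{broadcast}(\mathrm{rreq}(\mathit{hops}_c,\mathit{rreqid},\mathit{dip},\mathit{dsn},\mathit{oip}_c,\mathit{osn}_c,\mathit{ip}_c))}N'$$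 be a transition with $\mathit{ip}_c\ne\mathit{oip}_c$. Then in state $N$ the routing table of node $\mathit{ip}_c$ has an entry (valid or invalid) for $\mathit{oip}_c$. Moreover, either the sequence number of that entry is greater than $\mathit{osn}_c$, or it equals $\mathit{osn}_c$, the hop count of the entry is at most $\mathit{hops}_c$, and the entry is valid. -/

import Mathlib

/-! The process algebra for wireless networks, instantiated with the AODV routing protocol. -/

noncomputable section

namespace AWN

/-- Sequential expressions over partial valuations of type `σ`, addresses `IP`, messages `M`,
application data `D` and defining-equation names `X`. Data expressions are functions of the
valuation with values in `Option`; an undefined expression blocks. -/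
inductive SeqP (σ IP M D X : Type*) where
  /-- `X(exp, …, exp)`; `args` maps the current valuation to the valuation that assigns the
  values of the arguments to the parameters of `name` and nothing to other variables. -/
  | call (name : X) (args : σ → σ)
  /-- `p + q` -/
  | choice (p q : SeqP σ IP M D X)
  /-- `[φ] p`; the condition `φ` may bind variables, so it yields the set of all valuations
  that extend the current one and satisfy `φ`. -/
  | guard (φ : σ → Set σ) (p : SeqP σ IP M D X)
  /-- `[[var := exp]] p`, as an update of the valuation -/
  | assign (upd : σ → Option σ) (p : SeqP σ IP M D X)
  | broadcast (ms : σ → Option M) (p : SeqP σ IP M D X)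
  | groupcast (dests : σ → Option (Set IP)) (ms : σ → Option M) (p : SeqP σ IP M D X)
  /-- `unicast(dest, ms). p ▸ q` -/
  | unicast (dest : σ → Option IP) (ms : σ → Option M) (p q : SeqP σ IP M D X)
  | send (ms : σ → Option M) (p : SeqP σ IP M D X)
  | deliver (data : σ → Option D) (p : SeqP σ IP M D X)
  /-- `receive(msg). p`; `bind m` stores `m` in the variable `msg`. -/
  | receive (bind : M → σ → σ) (p : SeqP σ IP M D X)

/-- Actions of sequential and of parallel expressions inside one node. -/
inductive Act (IP M D : Type*) where
  | broadcast (m : M)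
  | groupcast (dests : Set IP) (m : M)
  | unicast (dest : IP) (m : M)
  /-- the unicast of `m` to `dest` fails -/
  | noUnicast (dest : IP) (m : M)
  | send (m : M)
  | deliver (d : D)
  | receive (m : M)
  | tau

variable {σ IP M D X : Type*}

/-- Operational semantics of sequential expressions, for the defining equations `Γ`. -/
inductive SeqStep (Γ : X → SeqP σ IP M D X) :
    σ × SeqP σ IP M D X → Act IP M D → σ × SeqP σ IP M D X → Prop where
  | call {ξ name args a s} (h : SeqStep Γ (args ξ, Γ name) a s) :
      SeqStep Γ (ξ, .call name args) a s
  | choiceLeft {ξ p q a s} (h : SeqStep Γ (ξ, p) a s) : SeqStep Γ (ξ, .choice p q) a s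
  | choiceRight {ξ p q a s} (h : SeqStep Γ (ξ, q) a s) : SeqStep Γ (ξ, .choice p q) a s
  | guard {ξ ζ φ p} (h : ζ ∈ φ ξ) : SeqStep Γ (ξ, .guard φ p) .tau (ζ, p)
  | assign {ξ ζ upd p} (h : upd ξ = some ζ) : SeqStep Γ (ξ, .assign upd p) .tau (ζ, p)
  | broadcast {ξ ms p m} (hm : ms ξ = some m) :
      SeqStep Γ (ξ, .broadcast ms p) (.broadcast m) (ξ, p)
  | groupcast {ξ dests ms p ds m} (hd : dests ξ = some ds) (hm : ms ξ = some m) :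
      SeqStep Γ (ξ, .groupcast dests ms p) (.groupcast ds m) (ξ, p)
  | unicast {ξ dest ms p q ip m} (hd : dest ξ = some ip) (hm : ms ξ = some m) :
      SeqStep Γ (ξ, .unicast dest ms p q) (.unicast ip m) (ξ, p)
  | noUnicast {ξ dest ms p q ip m} (hd : dest ξ = some ip) (hm : ms ξ = some m) :
      SeqStep Γ (ξ, .unicast dest ms p q) (.noUnicast ip m) (ξ, q)
  | send {ξ ms p m} (hm : ms ξ = some m) : SeqStep Γ (ξ, .send ms p) (.send m) (ξ, p)
  | deliver {ξ data p d} (hd : data ξ = some d) :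
      SeqStep Γ (ξ, .deliver data p) (.deliver d) (ξ, p)
  | receive {ξ bind p} (m : M) : SeqStep Γ (ξ, .receive bind p) (.receive m) (bind m ξ, p)

/-- Semantics of `P ⟨⟨ Q` inside one node: `P` receives what `Q` sends; the environment's
messages are received by `Q` only. -/
inductive ParStep {α β : Type*} (SP : α → Act IP M D → α → Prop)
    (SQ : β → Act IP M D → β → Prop) : α × β → Act IP M D → α × β → Prop where
  | left {P P' Q a} (h : SP P a P') (ha : ∀ m, a ≠ .receive m) : ParStep SP SQ (P, Q) a (P', Q)
  | right {P Q Q' a} (h : SQ Q a Q') (ha : ∀ m, a ≠ .send m) : ParStep SP SQ (P, Q) a (P, Q')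
  | sync {P P' Q Q' m} (hP : SP P (.receive m) P') (hQ : SQ Q (.send m) Q') :
      ParStep SP SQ (P, Q) .tau (P', Q')

/-- Network expressions: parallel compositions of nodes `ip : P : R`, with address `ip`,
local state `P`, and `R` the set of addresses currently in transmission range. -/
inductive Net (IP π : Type*) where
  | node (ip : IP) (P : π) (R : Set IP)
  | par (M N : Net IP π)

/-- Actions of (partial) network expressions. -/
inductive NAct (IP M D : Type*) where
  /-- `R : *cast(m)`, the transmission (broadcast, groupcast or unicast) of `m`, received by
  exactly the nodes with address in `R` -/
  | cast (R : Set IP) (m : M)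
  /-- `H ¬ K : arrive(m)`: `m` arrives at the nodes in `H` and does not arrive at those in `K` -/
  | arrive (H K : Set IP) (m : M)
  | deliver (ip : IP) (d : D)
  | connect (ip ip' : IP)
  | disconnect (ip ip' : IP)
  | tau

/-- Operational semantics of network expressions, for the semantics `S` of local states. -/
inductive NetStep {π : Type*} (S : π → Act IP M D → π → Prop) :
    Net IP π → NAct IP M D → Net IP π → Prop where
  | broadcast {ip P P' R m} (h : S P (.broadcast m) P') :
      NetStep S (.node ip P R) (.cast R m) (.node ip P' R)
  | groupcast {ip P P' R ds m} (h : S P (.groupcast ds m) P') :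
      NetStep S (.node ip P R) (.cast (R ∩ ds) m) (.node ip P' R)
  | unicast {ip P P' R dip m} (h : S P (.unicast dip m) P') (hR : dip ∈ R) :
      NetStep S (.node ip P R) (.cast {dip} m) (.node ip P' R)
  | noUnicast {ip P P' R dip m} (h : S P (.noUnicast dip m) P') (hR : dip ∉ R) :
      NetStep S (.node ip P R) .tau (.node ip P' R)
  | deliver {ip P P' R d} (h : S P (.deliver d) P') :
      NetStep S (.node ip P R) (.deliver ip d) (.node ip P' R)
  | receive {ip P P' R m} (h : S P (.receive m) P') :
      NetStep S (.node ip P R) (.arrive {ip} ∅ m) (.node ip P' R)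
  | ignore {ip P R m} : NetStep S (.node ip P R) (.arrive ∅ {ip} m) (.node ip P R)
  | tau {ip P P' R} (h : S P .tau P') : NetStep S (.node ip P R) .tau (.node ip P' R)
  | connectFst {ip ip' P R} :
      NetStep S (.node ip P R) (.connect ip ip') (.node ip P (R ∪ {ip'}))
  | connectSnd {ip ip' P R} :
      NetStep S (.node ip P R) (.connect ip' ip) (.node ip P (R ∪ {ip'}))
  | connectOther {ip i j P R} (hi : ip ≠ i) (hj : ip ≠ j) :
      NetStep S (.node ip P R) (.connect i j) (.node ip P R)
  | disconnectFst {ip ip' P R} :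
      NetStep S (.node ip P R) (.disconnect ip ip') (.node ip P (R \ {ip'}))
  | disconnectSnd {ip ip' P R} :
      NetStep S (.node ip P R) (.disconnect ip' ip) (.node ip P (R \ {ip'}))
  | disconnectOther {ip i j P R} (hi : ip ≠ i) (hj : ip ≠ j) :
      NetStep S (.node ip P R) (.disconnect i j) (.node ip P R)
  | castLeft {A A' B B' R H K m} (hA : NetStep S A (.cast R m) A')
      (hB : NetStep S B (.arrive H K m) B') (hH : H ⊆ R) (hK : K ∩ R = ∅) :
      NetStep S (.par A B) (.cast R m) (.par A' B')
  | castRight {A A' B B' R H K m} (hA : NetStep S A (.arrive H K m) A')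
      (hB : NetStep S B (.cast R m) B') (hH : H ⊆ R) (hK : K ∩ R = ∅) :
      NetStep S (.par A B) (.cast R m) (.par A' B')
  | arrive {A A' B B' H K H' K' m} (hA : NetStep S A (.arrive H K m) A')
      (hB : NetStep S B (.arrive H' K' m) B') :
      NetStep S (.par A B) (.arrive (H ∪ H') (K ∪ K') m) (.par A' B')
  | deliverLeft {A A' B ip d} (h : NetStep S A (.deliver ip d) A') :
      NetStep S (.par A B) (.deliver ip d) (.par A' B)
  | deliverRight {A B B' ip d} (h : NetStep S B (.deliver ip d) B') :
      NetStep S (.par A B) (.deliver ip d) (.par A B')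
  | tauLeft {A A' B} (h : NetStep S A .tau A') : NetStep S (.par A B) .tau (.par A' B)
  | tauRight {A B B'} (h : NetStep S B .tau B') : NetStep S (.par A B) .tau (.par A B')
  | connect {A A' B B' i j} (hA : NetStep S A (.connect i j) A')
      (hB : NetStep S B (.connect i j) B') :
      NetStep S (.par A B) (.connect i j) (.par A' B')
  | disconnect {A A' B B' i j} (hA : NetStep S A (.disconnect i j) A')
      (hB : NetStep S B (.disconnect i j) B') :
      NetStep S (.par A B) (.disconnect i j) (.par A' B')

/-- The addresses of the nodes of a network, with multiplicity. -/
def Net.addresses {π : Type*} : Net IP π → List IP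
  | .node ip _ _ => [ip]
  | .par A B => A.addresses ++ B.addresses

/-- Every node `ip : P : R` of the network satisfies `Q ip P`. -/
def Net.AllNodes {π : Type*} (Q : IP → π → Prop) : Net IP π → Prop
  | .node ip P _ => Q ip P
  | .par A B => A.AllNodes Q ∧ B.AllNodes Q

open Classical in
/-- The local state of the node with address `ip`, if there is one. -/
def Net.find {π : Type*} : Net IP π → IP → Option π
  | .node ip' P _, ip => if ip' = ip then some P else none
  | .par A B, ip => (A.find ip).or (B.find ip)

end AWN

namespace AODV

open AWN

variable {IP Data : Type}

/-! ### Data structures -/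

inductive Flag where
  | val
  | inval

/-- The part `(dsn, flag, hops, nhip, pre)` of a routing table entry
`(dip, dsn, flag, hops, nhip, pre)`. -/
@[ext] structure Entry (IP : Type) where
  dsn : ℕ
  flag : Flag
  hops : ℕ
  nhip : IP
  pre : Set IP

/-- Routing tables: at most one entry for each destination. -/
abbrev RT (IP : Type) := IP → Option (Entry IP)

/-- Sets of pairs `(rip, rsn)` with at most one `rsn` for each `rip`. -/
abbrev Dests (IP : Type) := IP → Option ℕ

inductive Msg (IP Data : Type) where
  | rreq (hops rreqid : ℕ) (dip : IP) (dsn : ℕ) (oip : IP) (osn : ℕ) (sip : IP)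
  | rrep (hops : ℕ) (dip : IP) (dsn : ℕ) (oip : IP) (sip : IP)
  | rerr (dests : Dests IP) (sip : IP)
  /-- injection of a data packet by the application layer -/
  | newpkt (data : Data) (dip : IP)
  | pkt (data : Data) (dip oip : IP)

/-- Increment of a sequence number; the unknown sequence number `0` is not incremented. -/
def inc (n : ℕ) : ℕ := if n = 0 then 0 else n + 1

/-- The sequence number for `dip`; it is `0` (unknown) if there is no entry. -/
def sqn (rt : RT IP) (dip : IP) : ℕ := ((rt dip).map Entry.dsn).getD 0

/-- The following four are undefined if there is no entry for `dip`. -/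
def status (rt : RT IP) (dip : IP) : Option Flag := (rt dip).map Entry.flag

def dhops (rt : RT IP) (dip : IP) : Option ℕ := (rt dip).map Entry.hops

def nhop (rt : RT IP) (dip : IP) : Option IP := (rt dip).map Entry.nhip

def precs (rt : RT IP) (dip : IP) : Option (Set IP) := (rt dip).map Entry.pre

/-- Destinations with an arbitrary entry, with a valid entry, and with an invalid entry. -/
def kD (rt : RT IP) : Set IP := {dip | ∃ e, rt dip = some e}

def akD (rt : RT IP) : Set IP := {dip | status rt dip = some .val}

def ikD (rt : RT IP) : Set IP := {dip | status rt dip = some .inval}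

open Classical in
/-- Update of `rt` with the entry `r` for the destination `dip`. -/
def update (rt : RT IP) (dip : IP) (r : Entry IP) : RT IP :=
  match rt dip with
  | none => Function.update rt dip (some r)
  | some s =>
    let nr : Entry IP := { r with pre := r.pre ∪ s.pre }
    let nr' : Entry IP := { nr with dsn := s.dsn }
    let ns : Entry IP := { s with pre := s.pre ∪ r.pre }
    Function.update rt dip <| some <|
      if s.dsn < r.dsn then nr
      else if s.dsn = r.dsn ∧ r.hops < s.hops then nr
      else if s.dsn = r.dsn ∧ s.flag = .inval then nr
      else if r.dsn = 0 then nr'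
      else ns

/-- Invalidation of the routes to the destinations in `dests`. -/
def invalidate (rt : RT IP) (dests : Dests IP) : RT IP := fun dip =>
  match rt dip, dests dip with
  | some e, some rsn => some { e with dsn := rsn, flag := .inval }
  | o, _ => o

open Classical in
/-- Addition of precursors to the entry for `dip`; undefined if there is no such entry. -/
def addpreRT (rt : RT IP) (dip : IP) (ps : Set IP) : Option (RT IP) :=
  (rt dip).map fun e => Function.update rt dip (some { e with pre := e.pre ∪ ps })

open Classical in
/-- A fresh identifier for a route request that originates at `ip`. -/
def nrreqid (rreqs : Finset (IP × ℕ)) (ip : IP) : ℕ :=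
  ((rreqs.filter fun x => x.1 = ip).sup Prod.snd) + 1

/-- The queued data packets for each destination. -/
abbrev Queues (IP Data : Type) := IP → List Data

/-- Destinations with queued packets. -/
def qD (queues : Queues IP Data) : Set IP := {dip | queues dip ≠ []}

open Classical in
/-- Appends a packet for `dip`. -/
def enqueue (data : Data) (dip : IP) (queues : Queues IP Data) : Queues IP Data :=
  Function.update queues dip (queues dip ++ [data])

open Classical in
/-- Removes the oldest packet for `dip`. -/
def drop (dip : IP) (queues : Queues IP Data) : Queues IP Data :=
  Function.update queues dip (queues dip).tail

/-! ### Valuations -/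

/-- Valuations of the variables of the protocol. The first five are maintained by the node and
are always defined; the others are local and may be undefined. -/
structure Vars (IP Data : Type) where
  ip : IP
  sn : ℕ
  rt : RT IP
  rreqs : Finset (IP × ℕ)
  queues : Queues IP Data
  msg : Option (Msg IP Data) := none
  data : Option Data := none
  hops : Option ℕ := none
  rreqid : Option ℕ := none
  dip : Option IP := none
  dsn : Option ℕ := none
  oip : Option IP := none
  osn : Option ℕ := none
  sip : Option IP := none
  dests : Option (Dests IP) := none
  pre : Option (Set IP) := none

/-- The valuation that keeps the five maintained variables only. -/
def Vars.base (s : Vars IP Data) : Vars IP Data :=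
  { ip := s.ip, sn := s.sn, rt := s.rt, rreqs := s.rreqs, queues := s.queues }

/-! ### The protocol -/

/-- Names of the defining equations. -/
inductive Name where
  | aodv
  | pkt
  | rreq
  | rrep
  | rerr

/-- Sequential expressions of the protocol. -/
abbrev Expr (IP Data : Type) := SeqP (Vars IP Data) IP (Msg IP Data) Data Name

/-- `[φ] p` for a condition that binds no variables. -/
def test (φ : Vars IP Data → Prop) (p : Expr IP Data) : Expr IP Data :=
  .guard (fun s => {s' | s' = s ∧ φ s}) p

/-- Call of the main routine. -/
def toMAIN : Expr IP Data := .call .aodv Vars.base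

open Classical in
/-- Given the set `dests` of the invalidated destinations: collect the precursors, restrict
`dests` to destinations with precursors, and send an error message to the precursors. -/
def sendRERR : Expr IP Data :=
  .assign (fun s => do
    let dests ← s.dests
    some { s with pre := some {p | ∃ rip ps,
      (dests rip).isSome ∧ precs s.rt rip = some ps ∧ p ∈ ps} }) <|
  .assign (fun s => do
    let dests ← s.dests
    some { s with dests := some fun rip =>
      if ∃ ps, precs s.rt rip = some ps ∧ ps ≠ ∅ then dests rip else none }) <|
  .groupcast (fun s => s.pre) (fun s => do some (.rerr (← s.dests) s.ip)) <|
  toMAIN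

open Classical in
/-- Reaction to a failed unicast to the next hop towards `dest`. -/
def linkBreak (dest : Vars IP Data → Option IP) : Expr IP Data :=
  .assign (fun s => do
    let d ← dest s
    some { s with dests := some fun rip =>
      if rip ∈ akD s.rt ∧ nhop s.rt rip = nhop s.rt d then some (inc (sqn s.rt rip))
      else none }) <|
  .assign (fun s => do some { s with rt := invalidate s.rt (← s.dests) }) <|
  sendRERR

/-- Update of the route to the one-hop neighbour `sip`. -/
def updateSender (p : Expr IP Data) : Expr IP Data :=
  .assign (fun s => do
    let sip ← s.sip
    some { s with rt := update s.rt sip ⟨0, .val, 1, sip, ∅⟩ }) p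

/-- Main routine: handling of a message from the message queue, or forwarding of a queued
data packet. -/
def MAIN : Expr IP Data :=
  .choice
    (.receive (fun m s => { s with msg := some m }) <|
      .choice
        (.guard (fun s => {s' | ∃ data dip, s.msg = some (.newpkt data dip) ∧
            s' = { s with data := some data, dip := some dip }}) <|
          .call .pkt fun s => { s.base with data := s.data, dip := s.dip, oip := some s.ip }) <|
      .choice
        (.guard (fun s => {s' | ∃ data dip oip, s.msg = some (.pkt data dip oip) ∧
            s' = { s with data := some data, dip := some dip, oip := some oip }}) <|
          .call .pkt fun s => { s.base with data := s.data, dip := s.dip, oip := s.oip }) <|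
      .choice
        (.guard (fun s => {s' | ∃ hops rreqid dip dsn oip osn sip,
            s.msg = some (.rreq hops rreqid dip dsn oip osn sip) ∧
            s' = { s with
              hops := some hops, rreqid := some rreqid, dip := some dip, dsn := some dsn,
              oip := some oip, osn := some osn, sip := some sip }}) <|
          updateSender <|
          .call .rreq fun s => { s.base with
            hops := s.hops, rreqid := s.rreqid, dip := s.dip, dsn := s.dsn,
            oip := s.oip, osn := s.osn, sip := s.sip }) <|
      .choice
        (.guard (fun s => {s' | ∃ hops dip dsn oip sip,
            s.msg = some (.rrep hops dip dsn oip sip) ∧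
            s' = { s with
              hops := some hops, dip := some dip, dsn := some dsn,
              oip := some oip, sip := some sip }}) <|
          updateSender <|
          .call .rrep fun s => { s.base with
            hops := s.hops, dip := s.dip, dsn := s.dsn, oip := s.oip, sip := s.sip })
        (.guard (fun s => {s' | ∃ dests sip, s.msg = some (.rerr dests sip) ∧
            s' = { s with dests := some dests, sip := some sip }}) <|
          updateSender <|
          .call .rerr fun s => { s.base with dests := s.dests, sip := s.sip }))
    (.guard (fun s => {s' | ∃ dip ∈ qD s.queues ∩ akD s.rt, s' = { s with dip := some dip }}) <|
      .assign (fun s => do some { s with data := some (← (s.queues (← s.dip)).head?) }) <|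
      .unicast (fun s => do nhop s.rt (← s.dip))
        (fun s => do some (.pkt (← s.data) (← s.dip) s.ip))
        (.assign (fun s => do some { s with queues := drop (← s.dip) s.queues }) toMAIN)
        (linkBreak Vars.dip))

open Classical in
/-- Handling of data packets. -/
def PKT : Expr IP Data :=
  .choice
    (test (fun s => s.dip = some s.ip) <| .deliver Vars.data toMAIN)
    (test (fun s => ∃ dip ∈ s.dip, dip ≠ s.ip) <|
      .choice
        -- a valid route is known: the packet is forwarded
        (test (fun s => ∃ dip ∈ s.dip, dip ∈ akD s.rt) <|
          .unicast (fun s => do nhop s.rt (← s.dip))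
            (fun s => do some (.pkt (← s.data) (← s.dip) (← s.oip)))
            toMAIN
            (linkBreak Vars.dip))
        (test (fun s => ∃ dip ∈ s.dip, dip ∉ akD s.rt) <|
          .choice
            -- a local packet is buffered, and a route discovery is initiated
            (test (fun s => s.oip = some s.ip) <|
              .assign (fun s => do
                some { s with queues := enqueue (← s.data) (← s.dip) s.queues }) <|
              .assign (fun s => some { s with sn := inc s.sn }) <|
              .assign (fun s => some { s with rreqid := some (nrreqid s.rreqs s.ip) }) <|
              .assign (fun s => do
                let rreqid ← s.rreqid
                some { s with rreqs := s.rreqs ∪ {(s.ip, rreqid)} }) <|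
              .broadcast (fun s => do
                let dip ← s.dip
                some (.rreq 0 (← s.rreqid) dip (sqn s.rt dip) s.ip s.sn s.ip)) <|
              toMAIN)
            (test (fun s => ∃ oip ∈ s.oip, oip ≠ s.ip) <|
              .choice
                -- the route is broken: the precursors are informed
                (test (fun s => ∃ dip ∈ s.dip, dip ∈ ikD s.rt) <|
                  .groupcast (fun s => do precs s.rt (← s.dip))
                    (fun s => do
                      let dip ← s.dip
                      some (.rerr (fun rip =>
                        if rip = dip then some (sqn s.rt dip) else none) s.ip)) <|
                  toMAIN)
                (test (fun s => ∃ dip ∈ s.dip, dip ∉ ikD s.rt) toMAIN))))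

/-- The route to `dip` is fresh enough to answer a request with sequence number `dsn`. -/
def FreshEnough (rt : RT IP) (dip : IP) (dsn : ℕ) : Prop :=
  dip ∈ akD rt ∧ dsn ≤ sqn rt dip ∧ sqn rt dip ≠ 0

open Classical in
/-- Handling of route requests. -/
def RREQ : Expr IP Data :=
  .choice
    (test (fun s => ∃ oip ∈ s.oip, ∃ rreqid ∈ s.rreqid, (oip, rreqid) ∈ s.rreqs) toMAIN)
    (test (fun s => ∃ oip ∈ s.oip, ∃ rreqid ∈ s.rreqid, (oip, rreqid) ∉ s.rreqs) <|
      .assign (fun s => do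
        some { s with
          rt := update s.rt (← s.oip) ⟨← s.osn, .val, (← s.hops) + 1, ← s.sip, ∅⟩ }) <|
      .assign (fun s => do
        let oip ← s.oip
        let rreqid ← s.rreqid
        some { s with rreqs := s.rreqs ∪ {(oip, rreqid)} }) <|
      .choice
        -- this node is the destination: reply
        (test (fun s => s.dip = some s.ip) <|
          .assign (fun s => do some { s with sn := max s.sn (← s.dsn) }) <|
          .unicast (fun s => do nhop s.rt (← s.oip))
            (fun s => do some (.rrep 0 (← s.dip) s.sn (← s.oip) s.ip))
            toMAIN
            (linkBreak Vars.oip))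
        (test (fun s => ∃ dip ∈ s.dip, dip ≠ s.ip) <|
          .choice
            -- a fresh enough route is known: reply on behalf of the destination
            (test (fun s => ∃ dip ∈ s.dip, ∃ dsn ∈ s.dsn, FreshEnough s.rt dip dsn) <|
              .assign (fun s => do
                some { s with rt := ← addpreRT s.rt (← s.dip) {← s.sip} }) <|
              .assign (fun s => do
                some { s with rt := ← addpreRT s.rt (← s.oip) {← nhop s.rt (← s.dip)} }) <|
              .unicast (fun s => do nhop s.rt (← s.oip))
                (fun s => do
                  let dip ← s.dip
                  some (.rrep (← dhops s.rt dip) dip (sqn s.rt dip) (← s.oip) s.ip))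
                toMAIN
                (linkBreak Vars.oip))
            -- otherwise the request is forwarded
            (test (fun s => ∃ dip ∈ s.dip, ∃ dsn ∈ s.dsn, ¬ FreshEnough s.rt dip dsn) <|
              .broadcast (fun s => do
                let dip ← s.dip
                some (.rreq ((← s.hops) + 1) (← s.rreqid) dip (max (sqn s.rt dip) (← s.dsn))
                  (← s.oip) (← s.osn) s.ip)) <|
              toMAIN)))

/-- The routing table after the update with the information in a route reply. -/
def rrepTable (s : Vars IP Data) : Option (RT IP) := do
  some (update s.rt (← s.dip) ⟨← s.dsn, .val, (← s.hops) + 1, ← s.sip, ∅⟩)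

/-- Handling of route replies. -/
def RREP : Expr IP Data :=
  .choice
    (test (fun s => ∃ rt ∈ rrepTable s, s.rt ≠ rt) <|
      .assign (fun s => do some { s with rt := ← rrepTable s }) <|
      .choice
        (test (fun s => s.oip = some s.ip) toMAIN)
        (test (fun s => ∃ oip ∈ s.oip, oip ≠ s.ip) <|
          .choice
            (test (fun s => ∃ oip ∈ s.oip, oip ∈ akD s.rt) <|
              .assign (fun s => do
                some { s with rt := ← addpreRT s.rt (← s.dip) {← nhop s.rt (← s.oip)} }) <|
              .assign (fun s => do
                some { s with
                  rt := ← addpreRT s.rt (← nhop s.rt (← s.dip)) {← nhop s.rt (← s.oip)} }) <|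
              .unicast (fun s => do nhop s.rt (← s.oip))
                (fun s => do
                  some (.rrep ((← s.hops) + 1) (← s.dip) (← s.dsn) (← s.oip) s.ip))
                toMAIN
                (linkBreak Vars.oip))
            (test (fun s => ∃ oip ∈ s.oip, oip ∉ akD s.rt) toMAIN)))
    (test (fun s => ∃ rt ∈ rrepTable s, s.rt = rt) toMAIN)

open Classical in
/-- The part of `dests` that concerns valid routes via `sip` with a smaller sequence number. -/
def brokenRoutes (rt : RT IP) (dests : Dests IP) (sip : IP) : Dests IP := fun rip =>
  if rip ∈ akD rt ∧ nhop rt rip = some sip ∧ ∃ rsn ∈ dests rip, sqn rt rip < rsn then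
    dests rip
  else none

/-- Handling of error messages: a route is invalidated only if the sequence number in the error
message is strictly greater than the one in the routing table. -/
def RERR : Expr IP Data :=
  .assign (fun s => do
    some { s with dests := some (brokenRoutes s.rt (← s.dests) (← s.sip)) }) <|
  .assign (fun s => do some { s with rt := invalidate s.rt (← s.dests) }) <|
  sendRERR

/-- The defining equations of the protocol. -/
def defs : Name → Expr IP Data
  | .aodv => MAIN
  | .pkt => PKT
  | .rreq => RREQ
  | .rrep => RREP
  | .rerr => RERR

/-! ### The message queue -/

/-- Valuations of the variables of the message queue. -/
structure QVars (IP Data : Type) where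
  msgs : List (Msg IP Data)
  msg : Option (Msg IP Data) := none

/-- Sequential expressions of the message queue; there is one defining equation. -/
abbrev QExpr (IP Data : Type) := SeqP (QVars IP Data) IP (Msg IP Data) Data Unit

/-- Storing an incoming message at the end of the queue. -/
def storeMsg : QExpr IP Data :=
  .receive (fun m s => { s with msg := some m }) <|
    .call () fun s => { msgs := s.msgs ++ s.msg.toList }

/-- The message queue: a first-in first-out buffer that is always ready to receive. -/
def QMSG : QExpr IP Data :=
  .choice storeMsg
    (.guard (fun s => {s' | s' = s ∧ s.msgs ≠ []}) <|
      .choice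
        (.send (fun s => s.msgs.head?) <| .call () fun s => { msgs := s.msgs.tail })
        storeMsg)

/-! ### Networks of nodes that run the protocol -/

/-- Local states of a node: the protocol and the message queue, each with its valuation. -/
abbrev Local (IP Data : Type) :=
  (Vars IP Data × Expr IP Data) × (QVars IP Data × QExpr IP Data)

/-- Semantics of `AODV ⟨⟨ QMSG`, the protocol together with the message queue. -/
def LocalStep : Local IP Data → Act IP (Msg IP Data) Data → Local IP Data → Prop :=
  ParStep (SeqStep defs) (SeqStep fun _ => QMSG)

abbrev Network (IP Data : Type) := Net IP (Local IP Data)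

/-- Actions of a complete network. -/
inductive Label (IP Data : Type) where
  | cast (R : Set IP) (m : Msg IP Data)
  /-- the application layer at node `ip` injects `data` for the destination `dip` -/
  | newpkt (ip : IP) (data : Data) (dip : IP)
  | deliver (ip : IP) (data : Data)
  | connect (ip ip' : IP)
  | disconnect (ip ip' : IP)
  | tau

/-- Transitions of a complete network: no message arrives from outside the network, except for
data packets injected by the application layer at a node. -/
inductive Step : Network IP Data → Label IP Data → Network IP Data → Prop where
  | cast {N N' R m} (h : NetStep LocalStep N (.cast R m) N') : Step N (.cast R m) N'
  | newpkt {N N' ip K data dip}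
      (h : NetStep LocalStep N (.arrive {ip} K (.newpkt data dip)) N') :
      Step N (.newpkt ip data dip) N'
  | deliver {N N' ip data} (h : NetStep LocalStep N (.deliver ip data) N') :
      Step N (.deliver ip data) N'
  | connect {N N' i j} (h : NetStep LocalStep N (.connect i j) N') : Step N (.connect i j) N'
  | disconnect {N N' i j} (h : NetStep LocalStep N (.disconnect i j) N') :
      Step N (.disconnect i j) N'
  | tau {N N'} (h : NetStep LocalStep N .tau N') : Step N .tau N'

/-- The local state of node `ip` before it has done anything. -/
def startState (ip : IP) : Local IP Data :=
  (({ ip := ip, sn := 1, rt := fun _ => none, rreqs := ∅, queues := fun _ => [] }, toMAIN),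
    ({ msgs := [] }, .call () id))

/-- Initial networks: distinct addresses, initial local states, and any connectivity. -/
def Initial (N : Network IP Data) : Prop :=
  N.addresses.Nodup ∧ N.AllNodes fun ip P => P = startState ip

/-- Networks reachable from an initial one. -/
def Reachable (N : Network IP Data) : Prop :=
  ∃ N₀, Initial N₀ ∧ Relation.ReflTransGen (fun M M' => ∃ l, Step M l M') N₀ N

/-- The routing table of node `ip` in the network state `N` (empty if there is no such node). -/
def table (N : Network IP Data) (ip : IP) : RT IP :=
  match N.find ip with
  | some P => P.1.1.rt
  | none => fun _ => none

end AODV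

end

/-!
The property depends on the sending node alone. In the protocol a message of type `rreq` is
broadcast at two places only. In `PKT` the sender is the originator, which the hypothesis
`ip ≠ oip` excludes. In `RREQ` the message is the forwarded copy of a request for which the node
has just performed the update of its routing table with `(oip, osn, val, hops + 1, sip)`, and only
tests and the bookkeeping of request identifiers lie between that update and the broadcast. Right
after the update the claim holds for every previous table (`routeAsGood_update`): an entry that
survives the update has a greater sequence number, or is valid with the same sequence number and
at most as many hops.

To make "between the update and the broadcast" precise, `AWN.SeqP.Safe` defines by recursion on a
sequential expression the weakest condition on the current valuation under which everything
transmitted before the next call of a defining equation is good, and every such call is made with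
good arguments. If the bodies of all defining equations are safe, then safety is preserved by all
transitions and implies that transmitted messages are good (`AWN.SeqP.Safe.step`). Safety of the
protocol (`safe_defs`) and of the message queue, which transmits nothing (`safe_qmsg`), is lifted
to networks as an invariant of all nodes (`Reachable.invariant`). Finally, a transmission in a
network comes from one of its nodes, and since addresses are distinct, `Net.find` returns the
state of this node (`AWN.NetStep.exists_sender`).
-/

namespace AWN

variable {σ IP M D X π : Type*}

/-! ### Safety of sequential expressions -/

/-- The action `a` transmits the message `m` to other nodes. -/
def Act.Casts (a : Act IP M D) (m : M) : Prop :=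
  a = .broadcast m ∨ (∃ ds, a = .groupcast ds m) ∨ ∃ ip, a = .unicast ip m

/-- The weakest condition on the valuation under which, up to the next call of a defining
equation, all transmitted messages are good in the sense of `G`, and the valuations passed to
calls satisfy `E`. The transition of a call is that of the body of its equation, so goodness with
respect to the arguments has to imply goodness with respect to the calling valuation. -/
def SeqP.Safe (E : σ → Prop) (G : σ → M → Prop) : SeqP σ IP M D X → σ → Prop
  | .call _ args, ξ => E (args ξ) ∧ ∀ m, G (args ξ) m → G ξ m
  | .choice p q, ξ => p.Safe E G ξ ∧ q.Safe E G ξ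
  | .guard φ p, ξ => ∀ ζ ∈ φ ξ, p.Safe E G ζ
  | .assign upd p, ξ => ∀ ζ, upd ξ = some ζ → p.Safe E G ζ
  | .broadcast ms p, ξ => (∀ m, ms ξ = some m → G ξ m) ∧ p.Safe E G ξ
  | .groupcast _ ms p, ξ => (∀ m, ms ξ = some m → G ξ m) ∧ p.Safe E G ξ
  | .unicast _ ms p q, ξ => (∀ m, ms ξ = some m → G ξ m) ∧ p.Safe E G ξ ∧ q.Safe E G ξ
  | .send _ p, ξ => p.Safe E G ξ
  | .deliver _ p, ξ => p.Safe E G ξ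
  | .receive bind p, ξ => ∀ m, p.Safe E G (bind m ξ)

theorem SeqP.Safe.step {E : σ → Prop} {G : σ → M → Prop} {Γ : X → SeqP σ IP M D X}
    (hΓ : ∀ name ξ, E ξ → (Γ name).Safe E G ξ) {s t : σ × SeqP σ IP M D X} {a : Act IP M D}
    (h : SeqStep Γ s a t) (hs : s.2.Safe E G s.1) :
    t.2.Safe E G t.1 ∧ ∀ m, a.Casts m → G s.1 m := by
  induction h with
  | call _ ih =>
    obtain ⟨h₁, h₂⟩ := ih (hΓ _ _ hs.1)
    exact ⟨h₁, fun m hm => hs.2 m (h₂ m hm)⟩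
  | choiceLeft _ ih => exact ih hs.1
  | choiceRight _ ih => exact ih hs.2
  | guard h => exact ⟨hs _ h, by simp [Act.Casts]⟩
  | assign h => exact ⟨hs _ h, by simp [Act.Casts]⟩
  | broadcast hm => exact ⟨hs.2, by simpa [Act.Casts] using hs.1 _ hm⟩
  | groupcast _ hm => exact ⟨hs.2, by simpa [Act.Casts] using hs.1 _ hm⟩
  | unicast _ hm => exact ⟨hs.2.1, by simpa [Act.Casts] using hs.1 _ hm⟩
  | noUnicast => exact ⟨hs.2.2, by simp [Act.Casts]⟩
  | send => exact ⟨hs, by simp [Act.Casts]⟩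
  | deliver => exact ⟨hs, by simp [Act.Casts]⟩
  | receive m => exact ⟨hs m, by simp [Act.Casts]⟩

/-! ### Networks -/

variable {S : π → Act IP M D → π → Prop} {N N' : Net IP π} {l : NAct IP M D}

theorem NetStep.addresses_eq (h : NetStep S N l N') : N'.addresses = N.addresses := by
  induction h <;> simp_all [Net.addresses]

theorem NetStep.allNodes {Q : IP → π → Prop} (hQ : ∀ ip P a P', S P a P' → Q ip P → Q ip P')
    (h : NetStep S N l N') (hN : N.AllNodes Q) : N'.AllNodes Q := by
  induction h <;> simp_all only [Net.AllNodes, and_self] <;> exact hQ _ _ _ _ ‹_› hN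

theorem Net.AllNodes.mono {Q Q' : IP → π → Prop} (hQ : ∀ ip P, Q ip P → Q' ip P)
    (hN : N.AllNodes Q) : N.AllNodes Q' := by
  induction N with
  | node => exact hQ _ _ hN
  | par A B ihA ihB => exact ⟨ihA hN.1, ihB hN.2⟩

theorem Net.AllNodes.of_find {Q : IP → π → Prop} (hN : N.AllNodes Q) {ip : IP} {P : π}
    (h : N.find ip = some P) : Q ip P := by
  induction N with
  | node ip' P' R =>
    simp only [Net.find, Option.ite_none_right_eq_some, Option.some.injEq] at h
    obtain ⟨rfl, rfl⟩ := h
    exact hN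
  | par A B ihA ihB =>
    simp only [Net.find, Option.or_eq_some_iff] at h
    obtain h | h := h
    · exact ihA hN.1 h
    · exact ihB hN.2 h.2

theorem Net.find_eq_none {ip : IP} (h : ip ∉ N.addresses) : N.find ip = none := by
  induction N with
  | node ip' P R => simpa [Net.find, Net.addresses, eq_comm] using h
  | par A B ihA ihB =>
    simp only [Net.addresses, List.mem_append, not_or] at h
    simp [Net.find, ihA h.1, ihB h.2]

theorem Net.mem_addresses_of_find {ip : IP} {P : π} (h : N.find ip = some P) :
    ip ∈ N.addresses := by
  by_contra hip
  simp [Net.find_eq_none hip] at h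

theorem NetStep.exists_sender {R : Set IP} {m : M} (h : NetStep S N (.cast R m) N')
    (hN : N.addresses.Nodup) :
    ∃ ip P P' a, N.find ip = some P ∧ S P a P' ∧ a.Casts m := by
  generalize hl : NAct.cast R m = l at h
  induction h with
  | broadcast h | groupcast h | unicast h =>
    cases hl
    exact ⟨_, _, _, _, if_pos rfl, h, by simp [Act.Casts]⟩
  | castLeft _ _ _ _ ih =>
    obtain ⟨ip, P, P', a, hP, h⟩ := ih (List.nodup_append.1 hN).1 hl
    exact ⟨ip, P, P', a, by simp [Net.find, hP], h⟩
  | castRight _ _ _ _ _ ih =>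
    obtain ⟨ip, P, P', a, hP, h⟩ := ih (List.nodup_append.1 hN).2.1 hl
    -- the search starts in the left component, which has no node with the address `ip`
    have hA := Net.find_eq_none
      ((List.nodup_append'.1 hN).2.2.symm (Net.mem_addresses_of_find hP))
    exact ⟨ip, P, P', a, by simp [Net.find, hP, hA], h⟩
  | _ => simp_all

end AWN

namespace AODV

open AWN

variable {IP Data : Type}

/-! ### Safety of the protocol -/

/-- The table has an entry for `oip`, and this entry is at least as good as a valid one with
sequence number `osn` and hop count `hops`. -/
def RouteAsGood (rt : RT IP) (oip : IP) (osn hops : ℕ) : Prop :=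
  oip ∈ kD rt ∧ (osn < sqn rt oip ∨
    (sqn rt oip = osn ∧ (∃ h, dhops rt oip = some h ∧ h ≤ hops) ∧ status rt oip = some .val))

theorem routeAsGood_update (rt : RT IP) (oip sip : IP) (osn hops : ℕ) (pre : Set IP) :
    RouteAsGood (update rt oip ⟨osn, .val, hops, sip, pre⟩) oip osn hops := by
  unfold RouteAsGood update
  cases hs : rt oip with
  | none => simp [kD, sqn, dhops, status]
  | some s =>
    obtain ⟨dsn, flag, h, nhip, pre'⟩ := s
    dsimp only
    cases flag <;> split_ifs <;> simp_all [kD, sqn, dhops, status] <;> omega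

/-- Goodness of a message transmitted by node `ip` with valuation `s`: a route request carries the
address of the node as that of its sender, and a request on behalf of another node is supported by
the routing table. -/
def GoodMsg (ip : IP) (s : Vars IP Data) : Msg IP Data → Prop
  | .rreq hops _ _ _ oip osn sip => sip = ip ∧ (sip ≠ oip → RouteAsGood s.rt oip osn hops)
  | _ => True

/-- Safety of an expression of the protocol at node `ip`; calls keep the address. -/
abbrev SafeAt (ip : IP) : Expr IP Data → Vars IP Data → Prop :=
  SeqP.Safe (fun s => s.ip = ip) (GoodMsg ip)

theorem safe_toMAIN {ip : IP} {s : Vars IP Data} (h : s.ip = ip) : SafeAt ip toMAIN s := by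
  refine ⟨h, fun m hm => ?_⟩
  cases m <;> exact hm

theorem safe_test {ip : IP} {s : Vars IP Data} {φ : Vars IP Data → Prop} {p : Expr IP Data}
    (h : φ s → SafeAt ip p s) : SafeAt ip (test φ p) s := by
  rintro _ ⟨rfl, hφ⟩
  exact h hφ

theorem safe_sendRERR {ip : IP} {s : Vars IP Data} (h : s.ip = ip) :
    SafeAt ip sendRERR s := by
  simp only [SafeAt, sendRERR, SeqP.Safe, Option.bind_eq_bind, Option.bind_eq_some_iff,
    Option.some.injEq]
  rintro _ ⟨_, _, rfl⟩ _ ⟨_, _, rfl⟩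
  refine ⟨?_, safe_toMAIN h⟩
  rintro _ ⟨_, _, rfl⟩
  trivial

theorem safe_linkBreak {ip : IP} {s : Vars IP Data} {dest : Vars IP Data → Option IP}
    (h : s.ip = ip) : SafeAt ip (linkBreak dest) s := by
  simp only [SafeAt, linkBreak, SeqP.Safe, Option.bind_eq_bind, Option.bind_eq_some_iff,
    Option.some.injEq]
  rintro _ ⟨_, _, rfl⟩ _ ⟨_, _, rfl⟩
  exact safe_sendRERR h

theorem safe_updateSender {ip : IP} {s : Vars IP Data} {p : Expr IP Data}
    (hp : ∀ s', s'.ip = s.ip → SafeAt ip p s') : SafeAt ip (updateSender p) s := by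
  simp only [SafeAt, updateSender, SeqP.Safe, Option.bind_eq_bind, Option.bind_eq_some_iff,
    Option.some.injEq]
  rintro _ ⟨_, _, rfl⟩
  exact hp _ rfl

/-- Calls whose arguments agree with the current valuation in the address and the routing
table. -/
theorem safe_call {ip : IP} {s : Vars IP Data} {name : Name} {args : Vars IP Data → Vars IP Data}
    (h : s.ip = ip) (hip : (args s).ip = s.ip) (hrt : (args s).rt = s.rt) :
    SafeAt ip (.call name args) s := by
  refine ⟨hip.trans h, fun m hm => ?_⟩
  cases m <;> simp_all [GoodMsg]

theorem safe_MAIN {ip : IP} {s : Vars IP Data} (h : s.ip = ip) : SafeAt ip MAIN s := by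
  refine ⟨fun m => ⟨?_, ?_, ?_, ?_, ?_⟩, ?_⟩
  · rintro _ ⟨_, _, _, rfl⟩
    exact safe_call h rfl rfl
  · rintro _ ⟨_, _, _, _, rfl⟩
    exact safe_call h rfl rfl
  · rintro _ ⟨_, _, _, _, _, _, _, _, rfl⟩
    exact safe_updateSender fun s' hs' => safe_call (hs'.trans h) rfl rfl
  · rintro _ ⟨_, _, _, _, _, _, rfl⟩
    exact safe_updateSender fun s' hs' => safe_call (hs'.trans h) rfl rfl
  · rintro _ ⟨_, _, _, rfl⟩
    exact safe_updateSender fun s' hs' => safe_call (hs'.trans h) rfl rfl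
  · rintro _ ⟨_, _, rfl⟩
    simp only [SeqP.Safe, Option.bind_eq_bind, Option.bind_eq_some_iff, Option.some.injEq]
    rintro _ ⟨_, _, _, _, rfl⟩
    refine ⟨?_, ?_, safe_linkBreak h⟩
    · rintro _ ⟨_, _, _, _, rfl⟩
      trivial
    · rintro _ ⟨_, _, rfl⟩
      exact safe_toMAIN h

theorem safe_PKT {ip : IP} {s : Vars IP Data} (h : s.ip = ip) : SafeAt ip PKT s := by
  refine ⟨safe_test fun _ => safe_toMAIN h, safe_test fun _ => ⟨safe_test fun _ => ?_,
    safe_test fun _ => ⟨safe_test fun _ => ?_,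
      safe_test fun _ => ⟨safe_test fun _ => ?_, safe_test fun _ => safe_toMAIN h⟩⟩⟩⟩
  · refine ⟨?_, safe_toMAIN h, safe_linkBreak h⟩
    simp only [Option.bind_eq_bind, Option.bind_eq_some_iff, Option.some.injEq]
    rintro _ ⟨_, _, _, _, _, _, rfl⟩
    trivial
  · simp only [SeqP.Safe, Option.bind_eq_bind, Option.bind_eq_some_iff, Option.some.injEq]
    rintro _ ⟨_, _, _, _, rfl⟩ _ rfl _ rfl _ ⟨_, _, rfl⟩
    refine ⟨?_, safe_toMAIN h⟩
    rintro _ ⟨_, _, _, _, rfl⟩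
    exact ⟨h, fun hne => absurd rfl hne⟩
  · refine ⟨?_, safe_toMAIN h⟩
    simp only [Option.bind_eq_bind, Option.bind_eq_some_iff, Option.some.injEq]
    rintro _ ⟨_, _, rfl⟩
    trivial

theorem safe_RREQ {ip : IP} {s : Vars IP Data} (h : s.ip = ip) : SafeAt ip RREQ s := by
  refine ⟨safe_test fun _ => safe_toMAIN h, safe_test fun _ => ?_⟩
  simp only [SeqP.Safe, Option.bind_eq_bind, Option.bind_eq_some_iff, Option.some.injEq]
  rintro _ ⟨oip, hoip, osn, hosn, hops, hhops, _, _, rfl⟩ _ ⟨_, _, _, _, rfl⟩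
  refine ⟨safe_test fun _ => ?_, safe_test fun _ => ⟨safe_test fun _ => ?_, safe_test fun _ => ?_⟩⟩
  · simp only [SeqP.Safe, Option.bind_eq_some_iff, Option.some.injEq]
    rintro _ ⟨_, _, rfl⟩
    refine ⟨?_, safe_toMAIN h, safe_linkBreak h⟩
    rintro _ ⟨_, _, _, _, rfl⟩
    trivial
  · simp only [SeqP.Safe, Option.bind_eq_some_iff, Option.some.injEq]
    rintro _ ⟨_, _, _, _, _, _, rfl⟩ _ ⟨_, _, _, _, _, _, _, _, rfl⟩
    refine ⟨?_, safe_toMAIN h, safe_linkBreak h⟩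
    rintro _ ⟨_, _, _, _, _, _, rfl⟩
    trivial
  · refine ⟨?_, safe_toMAIN h⟩
    simp only [Option.bind_eq_some_iff, Option.some.injEq, hoip, hosn, hhops]
    rintro _ ⟨_, _, _, rfl, _, _, _, _, _, rfl, _, rfl, rfl⟩
    exact ⟨h, fun _ => routeAsGood_update ..⟩

theorem safe_RREP {ip : IP} {s : Vars IP Data} (h : s.ip = ip) : SafeAt ip RREP s := by
  refine ⟨safe_test fun _ => ?_, safe_test fun _ => safe_toMAIN h⟩
  simp only [SeqP.Safe, Option.bind_eq_bind, Option.bind_eq_some_iff, Option.some.injEq]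
  rintro _ ⟨_, _, rfl⟩
  refine ⟨safe_test fun _ => safe_toMAIN h, safe_test fun _ => ⟨safe_test fun _ => ?_,
    safe_test fun _ => safe_toMAIN h⟩⟩
  simp only [SeqP.Safe, Option.bind_eq_some_iff, Option.some.injEq]
  rintro _ ⟨_, _, _, _, _, _, _, _, rfl⟩ _ ⟨_, _, _, _, _, _, _, _, _, _, rfl⟩
  refine ⟨?_, safe_toMAIN h, safe_linkBreak h⟩
  rintro _ ⟨_, _, _, _, _, _, _, _, rfl⟩
  trivial

theorem safe_RERR {ip : IP} {s : Vars IP Data} (h : s.ip = ip) : SafeAt ip RERR s := by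
  simp only [SafeAt, RERR, SeqP.Safe, Option.bind_eq_bind, Option.bind_eq_some_iff,
    Option.some.injEq]
  rintro _ ⟨_, _, _, _, rfl⟩ _ ⟨_, _, rfl⟩
  exact safe_sendRERR h

theorem safe_defs (ip : IP) (name : Name) (s : Vars IP Data) (h : s.ip = ip) :
    SafeAt ip (defs name) s := by
  cases name
  · exact safe_MAIN h
  · exact safe_PKT h
  · exact safe_RREQ h
  · exact safe_RREP h
  · exact safe_RERR h

/-! ### Safety of the message queue -/

/-- Safety of an expression of the message queue: no message is transmitted to other nodes. -/
abbrev SafeQ : QExpr IP Data → QVars IP Data → Prop :=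
  SeqP.Safe (fun _ => True) (fun _ _ => False)

theorem safe_qmsg (s : QVars IP Data) : SafeQ QMSG s := by
  simp [SafeQ, QMSG, storeMsg, SeqP.Safe]

/-! ### The invariant of networks -/

/-- Both components of the local state of node `ip` are safe. -/
def SafeLocal (ip : IP) (P : Local IP Data) : Prop :=
  SafeAt ip P.1.2 P.1.1 ∧ SafeQ P.2.2 P.2.1

theorem LocalStep.safe {ip : IP} {P P' : Local IP Data} {a : Act IP (Msg IP Data) Data}
    (h : LocalStep P a P') (hP : SafeLocal ip P) :
    SafeLocal ip P' ∧ ∀ m, a.Casts m → GoodMsg ip P.1.1 m := by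
  have hQ : ∀ (name : Unit) (s : QVars IP Data), True → SafeQ QMSG s := fun _ s _ => safe_qmsg s
  cases h with
  | left h =>
    have := SeqP.Safe.step (safe_defs ip) h hP.1
    exact ⟨⟨this.1, hP.2⟩, this.2⟩
  | right h =>
    have := SeqP.Safe.step hQ h hP.2
    exact ⟨⟨hP.1, this.1⟩, fun m hm => (this.2 m hm).elim⟩
  | sync h₁ h₂ =>
    exact ⟨⟨(SeqP.Safe.step (safe_defs ip) h₁ hP.1).1, (SeqP.Safe.step hQ h₂ hP.2).1⟩,
      by simp [Act.Casts]⟩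

theorem Step.netStep {N N' : Network IP Data} {l : Label IP Data} (h : Step N l N') :
    ∃ a, NetStep LocalStep N a N' := by
  cases h <;> exact ⟨_, ‹_›⟩

theorem Reachable.invariant {N : Network IP Data} (hN : Reachable N) :
    N.addresses.Nodup ∧ N.AllNodes SafeLocal := by
  obtain ⟨N₀, ⟨hnd, hstart⟩, hsteps⟩ := hN
  induction hsteps with
  | refl =>
    refine ⟨hnd, hstart.mono ?_⟩
    rintro ip _ rfl
    exact ⟨safe_toMAIN rfl, trivial, fun _ => id⟩
  | tail _ h ih =>
    obtain ⟨l, hl⟩ := h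
    obtain ⟨a, ha⟩ := hl.netStep
    exact ⟨ha.addresses_eq ▸ ih.1, ha.allNodes (fun _ _ _ _ h hP => (LocalStep.safe h hP).1) ih.2⟩

end AODV

theorem mainTheorem5 {IP Data : Type} (N N' : AODV.Network IP Data) (hN : AODV.Reachable N)
    (R : Set IP) (hops rreqid : ℕ) (dip : IP) (dsn : ℕ) (oip : IP) (osn : ℕ) (ip : IP)
    (hstep : AODV.Step N (.cast R (.rreq hops rreqid dip dsn oip osn ip)) N')
    (hne : ip ≠ oip) :
    oip ∈ AODV.kD (AODV.table N ip) ∧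
      (osn < AODV.sqn (AODV.table N ip) oip ∨
        (AODV.sqn (AODV.table N ip) oip = osn ∧
          (∃ h, AODV.dhops (AODV.table N ip) oip = some h ∧ h ≤ hops) ∧
          AODV.status (AODV.table N ip) oip = some .val)) := by
  obtain ⟨hnd, hsafe⟩ := hN.invariant
  cases hstep with
  | cast h =>
    obtain ⟨ip', P, P', a, hP, ha, hm⟩ := h.exists_sender hnd
    obtain ⟨rfl, hgood⟩ := (AODV.LocalStep.safe ha (hsafe.of_find hP)).2 _ hm
    have ht : AODV.table N ip = P.1.1.rt := by simp [AODV.table, hP]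
    rw [ht]
    exact hgood hne
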